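/- All metric spaces are assumed to contain at least two points, balls $B(x,t)=\{y: d(x,y)<t\}$ are open, and $\operatorname{diam} X=\infty$ if $X$ is unbounded. For a metric space $(X,d)$ with a Borel regular measure $\nu$: (a) $X$ is Ahlfors $Q$-regular ($Q>0$) if there is $C\ge 1$ with $C^{-1}t^{Q}\le \nu(B(x,t))\le C t^{Q}$ for all $x\in X$ and $0<t<2\operatorname{diam}X$. (b) For $1\le p<\infty$ and $s>0$, the Besov space $B^s_{p,p}(X)$ is the normed space of all $u\in L^p(X)$ (real-valued, modulo equality $\nu$-a.e.) with $$\|u\|_{B^s_{p,p}(X)}=\|u\|_{L^p(X)}+\left(\int_X\int_X\frac{|u(x)-u(y)|^p}{d(x,y)^{sp}}\,\frac{d\nu(x)\,d\nu(y)}{\nu(B(x,d(x,y)))}\right)^{1/p}<\infty .$$ (c) A homeomorphism (onto) $f:(Z,d_Z)\to(W,d_W)$ is locally $(\theta_1,\theta_2,r)$-biHölder continuous, where $\theta_1,\theta_2>0$ and $0<r<2\operatorname{diam}Z$, if there is $C\ge1$ with $C^{-1}d_Z(x,y)^{\theta_1}\le d_W(f(x),f(y))\le C\,d_Z(x,y)^{\theta_2}$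 for all $x,y\in Z$ with $d_Z(x,y)<r$. **Theorem.** Let $(Z,d_Z,\nu_Z)$ be Ahlfors $Q_Z$-regular and $(W,d_W,\nu_W)$ be Ahlfors $Q_W$-regular, with $Q_Z,Q_W>0$, and let $\theta_1>0$, $\theta_2>0$, $s>0$, $s'>0$ and $1\le p<\infty$ satisfy $$Q_Z\ge\theta_1Q_W\quad\text{and}\quad s'\le\theta_2 s+\frac{\theta_2Q_W-Q_Z}{p}.$$ Let $f:Z\to W$ be locally $(\theta_1,\theta_2,r)$-biHölder continuous with $0<r<2\operatorname{diam}Z$. Then $f_{\#}(u)=u\circ f$ is well defined on $\nu_W$-a.e. equivalence classes and is a bounded injective linear map $f_{\#}:B^s_{p,p}(W)\to B^{s'}_{p,p}(Z)$. -/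

import Mathlib

open MeasureTheory Metric Set
open scoped ENNReal

section AhlforsRegular

variable {Z : Type*} [MetricSpace Z] [MeasurableSpace Z]

/-- `ν` is Ahlfors `Q`-regular: `C⁻¹ r ^ Q ≤ ν (B(z, r)) ≤ C r ^ Q` for all `z` and all
`0 < r < 2 diam Z`, where `diam Z` is `∞` if `Z` is unbounded. -/
def IsAhlforsRegular (ν : Measure Z) (Q : ℝ) : Prop :=
  ∃ C : ℝ, 1 ≤ C ∧ ∀ (z : Z) (r : ℝ), 0 < r → ENNReal.ofReal r < 2 * ediam (univ : Set Z) →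
    ENNReal.ofReal (C⁻¹ * r ^ Q) ≤ ν (ball z r) ∧ ν (ball z r) ≤ ENNReal.ofReal (C * r ^ Q)

namespace IsAhlforsRegular

variable {ν : Measure Z} {Q : ℝ}

theorem measure_ball_lt_top [Nontrivial Z] (h : IsAhlforsRegular ν Q) (z : Z) (r : ℝ) :
    ν (ball z r) < ∞ := by
  obtain ⟨C, -, hC⟩ := h
  by_cases hb : ediam (univ : Set Z) = ∞
  · rcases le_or_gt r 0 with hr | hr
    · simp [ball_eq_empty.2 hr]
    · exact ((hC z r hr (by simp [hb])).2).trans_lt ENNReal.ofReal_lt_top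
  · have hpos : 0 < ediam (univ : Set Z) := ediam_pos_iff.2 nontrivial_univ
    obtain ⟨D, hD1, hD2⟩ : ∃ D, ediam (univ : Set Z) < D ∧ D < 2 * ediam (univ : Set Z) := by
      apply exists_between
      rw [two_mul]
      exact ENNReal.lt_add_right hb hpos.ne'
    have hDt : D ≠ ∞ := hD2.ne_top
    have hsub : ball z r ⊆ ball z D.toReal := by
      intro y _
      rw [mem_ball, dist_edist]
      exact (ENNReal.toReal_lt_toReal (edist_ne_top _ _) hDt).2
        ((edist_le_ediam_of_mem (mem_univ y) (mem_univ z)).trans_lt hD1)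
    refine (measure_mono hsub).trans_lt (((hC z D.toReal
      (ENNReal.toReal_pos (hpos.trans hD1).ne' hDt) ?_).2).trans_lt ENNReal.ofReal_lt_top)
    rwa [ENNReal.ofReal_toReal hDt]

theorem measure_ball_pos [Nontrivial Z] (h : IsAhlforsRegular ν Q) (z : Z) {r : ℝ} (hr : 0 < r) :
    0 < ν (ball z r) := by
  obtain ⟨C, hC1, hC⟩ := h
  have hpos : 0 < 2 * ediam (univ : Set Z) :=
    ENNReal.mul_pos (by simp) (ediam_pos_iff.2 nontrivial_univ).ne'
  obtain ⟨D, hD0, hD⟩ := exists_between hpos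
  have hDt : D ≠ ∞ := hD.ne_top
  have hD0' := ENNReal.toReal_pos hD0.ne' hDt
  have hm : 0 < min r D.toReal := lt_min hr hD0'
  have h1 := (hC z (min r D.toReal) hm (lt_of_le_of_lt
    ((ENNReal.ofReal_le_ofReal (min_le_right _ _)).trans_eq (ENNReal.ofReal_toReal hDt)) hD)).1
  have h2 : (0 : ℝ≥0∞) < ENNReal.ofReal (C⁻¹ * (min r D.toReal) ^ Q) := by
    rw [ENNReal.ofReal_pos]
    have : 0 < C := by linarith
    positivity
  exact (h2.trans_le h1).trans_le (measure_mono (ball_subset_ball (min_le_left _ _)))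

theorem sigmaFinite [Nontrivial Z] (h : IsAhlforsRegular ν Q) : SigmaFinite ν := by
  obtain ⟨z⟩ : Nonempty Z := inferInstance
  exact ⟨⟨⟨fun n => ball z n, fun _ => trivial, fun n => h.measure_ball_lt_top z n,
    iUnion_ball_nat z⟩⟩⟩

theorem secondCountableTopology [Nontrivial Z] [BorelSpace Z] (h : IsAhlforsRegular ν Q) :
    SecondCountableTopology Z := by
  have := h.sigmaFinite
  refine secondCountable_of_almost_dense_set fun ε hε => ?_
  obtain ⟨s, hs⟩ := zorn_subset {s : Set Z | s.Pairwise fun x y => ε < dist x y} (by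
    intro c hc hchain
    refine ⟨⋃₀ c, ?_, fun t ht => subset_sUnion_of_mem ht⟩
    exact (pairwise_sUnion hchain.directedOn).2 fun t ht => hc ht)
  refine ⟨s, ?_, fun x => ?_⟩
  · have hcount := Measure.countable_meas_pos_of_disjoint_iUnion (μ := ν)
      (As := fun x : s => ball (x : Z) (ε / 2)) (fun x => isOpen_ball.measurableSet) (by
        intro x y hxy
        apply ball_disjoint_ball
        have := hs.prop x.2 y.2 (fun h => hxy (Subtype.ext h))
        linarith)
    have : {x : s | 0 < ν (ball (x : Z) (ε / 2))} = univ :=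
      eq_univ_of_forall fun x => h.measure_ball_pos _ (half_pos hε)
    rw [this] at hcount
    exact countable_coe_iff.1 (countable_univ_iff.1 hcount)
  · by_contra! hx
    have hins : insert x s ∈ {s : Set Z | s.Pairwise fun x y => ε < dist x y} := by
      refine hs.prop.insert fun y hy _ => ⟨hx y hy, ?_⟩
      rw [dist_comm]
      exact hx y hy
    have hxs : x ∈ s := hs.le_of_ge hins (subset_insert x s) (mem_insert x s)
    have := hx x hxs
    rw [dist_self] at this
    linarith

end IsAhlforsRegular

end AhlforsRegular

/-- The bounds that make a homeomorphism locally `(θ₁, θ₂, r)`-biHölder continuous. -/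
def IsLocallyBiHolder {Z W : Type*} [MetricSpace Z] [MetricSpace W] (f : Z ≃ₜ W)
    (θ₁ θ₂ r : ℝ) : Prop :=
  ∃ C : ℝ, 1 ≤ C ∧ ∀ x y : Z, dist x y < r →
    C⁻¹ * dist x y ^ θ₁ ≤ dist (f x) (f y) ∧ dist (f x) (f y) ≤ C * dist x y ^ θ₂

noncomputable section Besov

variable {Z : Type*} [MetricSpace Z] [MeasurableSpace Z]

/-- The homogeneous Besov (semi)norm of `u`, with values in `[0, ∞]`. The integrand is `0` on the
diagonal, by the conventions for division in `[0, ∞]`. -/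
def besovSeminorm (s p : ℝ) (ν : Measure Z) (u : Z → ℝ) : ℝ≥0∞ :=
  (∫⁻ y, ∫⁻ x, ENNReal.ofReal |u x - u y| ^ p / edist x y ^ (s * p) / ν (ball x (dist x y)) ∂ν ∂ν)
    ^ (1 / p)

/-- An auxiliary weighted measure on `Z × Z`, used only to check the norm axioms. -/
def besovMeasure (s p : ℝ) (ν : Measure Z) : Measure (Z × Z) :=
  (ν.prod ν).withDensity
    fun z => (edist z.1 z.2 ^ (s * p))⁻¹ * (ν (ball z.1 (dist z.1 z.2)))⁻¹

theorem besovSeminorm_congr {s p : ℝ} {ν : Measure Z} {u v : Z → ℝ} (h : u =ᵐ[ν] v) :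
    besovSeminorm s p ν u = besovSeminorm s p ν v := by
  unfold besovSeminorm
  congr 1
  refine lintegral_congr_ae ?_
  filter_upwards [h] with y hy
  refine lintegral_congr_ae ?_
  filter_upwards [h] with x hx
  rw [hx, hy]

theorem besovSeminorm_eq [BorelSpace Z] [SecondCountableTopology Z] {ν : Measure Z} [SFinite ν]
    (s : ℝ) {p : ℝ} (hp : 1 ≤ p) {u : Z → ℝ} (hu : Measurable u) :
    besovSeminorm s p ν u =
      eLpNorm (fun z : Z × Z => u z.1 - u z.2) (ENNReal.ofReal p) (besovMeasure s p ν) := by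
  have hp0 : 0 < p := by linarith
  have hball : Measurable fun z : Z × Z => ν (ball z.1 (dist z.1 z.2)) := by
    have hm : MeasurableSet {q : (Z × Z) × Z | dist q.2 q.1.1 < dist q.1.1 q.1.2} :=
      measurableSet_lt (by fun_prop) (by fun_prop)
    exact measurable_measure_prodMk_left hm
  have hk : Measurable fun z : Z × Z =>
      (edist z.1 z.2 ^ (s * p))⁻¹ * (ν (ball z.1 (dist z.1 z.2)))⁻¹ :=
    (Measurable.pow_const (by fun_prop) _).inv.mul hball.inv
  have hd : Measurable fun z : Z × Z => ‖u z.1 - u z.2‖ₑ ^ p := by fun_prop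
  rw [eLpNorm_eq_lintegral_rpow_enorm_toReal (by simpa using hp0) ENNReal.ofReal_ne_top,
    ENNReal.toReal_ofReal hp0.le, besovMeasure, lintegral_withDensity_eq_lintegral_mul _ hk hd,
    lintegral_prod_symm' _ (hk.mul hd), besovSeminorm]
  congr 1
  refine lintegral_congr fun y => lintegral_congr fun x => ?_
  simp only [Pi.mul_apply, div_eq_mul_inv, Real.enorm_eq_ofReal_abs]
  ring

variable [BorelSpace Z] [Nontrivial Z] {ν : Measure Z} {Q : ℝ}

theorem besovSeminorm_add_le (hν : IsAhlforsRegular ν Q) (s : ℝ) {p : ℝ} (hp : 1 ≤ p)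
    (u v : Lp ℝ (ENNReal.ofReal p) ν) :
    besovSeminorm s p ν ⇑(u + v) ≤ besovSeminorm s p ν u + besovSeminorm s p ν v := by
  have := hν.sigmaFinite
  have := hν.secondCountableTopology
  have hu := (Lp.stronglyMeasurable u).measurable
  have hv := (Lp.stronglyMeasurable v).measurable
  rw [besovSeminorm_congr (Lp.coeFn_add u v), besovSeminorm_eq s hp (hu.add hv),
    besovSeminorm_eq s hp hu, besovSeminorm_eq s hp hv]
  have hfun : (fun z : Z × Z => (⇑u + ⇑v) z.1 - (⇑u + ⇑v) z.2) =
      (fun z : Z × Z => u z.1 - u z.2) + fun z : Z × Z => v z.1 - v z.2 := by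
    funext z
    simp only [Pi.add_apply]
    ring
  rw [hfun]
  exact eLpNorm_add_le (by fun_prop) (by fun_prop) (by simpa using hp)

theorem besovSeminorm_smul (hν : IsAhlforsRegular ν Q) (s : ℝ) {p : ℝ} (hp : 1 ≤ p)
    (c : ℝ) (u : Lp ℝ (ENNReal.ofReal p) ν) :
    besovSeminorm s p ν ⇑(c • u) = ENNReal.ofReal |c| * besovSeminorm s p ν u := by
  have := hν.sigmaFinite
  have := hν.secondCountableTopology
  have hu := (Lp.stronglyMeasurable u).measurable
  rw [besovSeminorm_congr (Lp.coeFn_smul c u), besovSeminorm_eq s hp (hu.const_smul c),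
    besovSeminorm_eq s hp hu]
  have hfun : (fun z : Z × Z => (c • ⇑u) z.1 - (c • ⇑u) z.2) =
      c • fun z : Z × Z => u z.1 - u z.2 := by
    funext z
    simp only [Pi.smul_apply, smul_eq_mul]
    ring
  rw [hfun, eLpNorm_const_smul, Real.enorm_eq_ofReal_abs]

theorem besovSeminorm_zero (hν : IsAhlforsRegular ν Q) (s : ℝ) {p : ℝ} (hp : 1 ≤ p) :
    besovSeminorm s p ν ⇑(0 : Lp ℝ (ENNReal.ofReal p) ν) = 0 := by
  have h := besovSeminorm_smul hν s hp 0 0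
  rw [zero_smul, abs_zero, ENNReal.ofReal_zero, zero_mul] at h
  exact h

/-- The elements of `L^p(Z)` with finite homogeneous Besov norm. The regularity of `ν` and
`1 ≤ p` serve to show that they form a linear subspace. -/
def besovSubmodule (hν : IsAhlforsRegular ν Q) (s : ℝ) {p : ℝ} (hp : 1 ≤ p) :
    Submodule ℝ (Lp ℝ (ENNReal.ofReal p) ν) where
  carrier := {u | besovSeminorm s p ν u < ∞}
  zero_mem' := by
    change besovSeminorm s p ν ⇑(0 : Lp ℝ (ENNReal.ofReal p) ν) < ∞
    rw [besovSeminorm_zero hν s hp]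
    exact ENNReal.zero_lt_top
  add_mem' {u v} hu hv :=
    (besovSeminorm_add_le hν s hp u v).trans_lt (ENNReal.add_lt_top.2 ⟨hu, hv⟩)
  smul_mem' c u hu := by
    change besovSeminorm s p ν ⇑(c • u) < ∞
    rw [besovSeminorm_smul hν s hp c u]
    exact ENNReal.mul_lt_top ENNReal.ofReal_lt_top hu

/-- The Besov space `B^s_{p,p}(Z)`; a type of its own, since its norm is not the `L^p` norm. -/
def BesovSpace (hν : IsAhlforsRegular ν Q) (s : ℝ) {p : ℝ} (hp : 1 ≤ p) : Type _ :=
  ↥(besovSubmodule hν s hp)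

namespace BesovSpace

variable {hν : IsAhlforsRegular ν Q} {s p : ℝ} {hp : 1 ≤ p}

instance : AddCommGroup (BesovSpace hν s hp) :=
  inferInstanceAs (AddCommGroup ↥(besovSubmodule hν s hp))

instance : Module ℝ (BesovSpace hν s hp) :=
  inferInstanceAs (Module ℝ ↥(besovSubmodule hν s hp))

/-- The inclusion `B^s_{p,p}(Z) → L^p(Z)`. -/
def toLp : BesovSpace hν s hp →ₗ[ℝ] Lp ℝ (ENNReal.ofReal p) ν :=
  (besovSubmodule hν s hp).subtype

theorem seminorm_toLp_ne_top (u : BesovSpace hν s hp) : besovSeminorm s p ν (toLp u) ≠ ∞ :=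
  LT.lt.ne u.2

/-- The norm `‖u‖_{L^p} + ‖u‖_{\dot B^s_{p,p}}`. -/
instance : NormedAddCommGroup (BesovSpace hν s hp) :=
  have : Fact (1 ≤ ENNReal.ofReal p) := ⟨by simpa using hp⟩
  AddGroupNorm.toNormedAddCommGroup
    { toFun := fun u => ‖toLp u‖ + (besovSeminorm s p ν (toLp u)).toReal
      map_zero' := by
        rw [map_zero, besovSeminorm_zero hν s hp]
        simp
      add_le' := fun u v => by
        have h1 := norm_add_le (toLp u) (toLp v)
        have h2 := ENNReal.toReal_mono
          (ENNReal.add_ne_top.2 ⟨seminorm_toLp_ne_top u, seminorm_toLp_ne_top v⟩)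
          (besovSeminorm_add_le hν s hp (toLp u) (toLp v))
        rw [ENNReal.toReal_add (seminorm_toLp_ne_top u) (seminorm_toLp_ne_top v)] at h2
        rw [map_add]
        linarith
      neg' := fun u => by
        have h := besovSeminorm_smul hν s hp (-1) (toLp u)
        rw [neg_one_smul] at h
        rw [map_neg, h, norm_neg]
        simp
      eq_zero_of_map_eq_zero' := fun u hu => by
        have h : ‖toLp u‖ = 0 := le_antisymm
          (by linarith [ENNReal.toReal_nonneg (a := besovSeminorm s p ν (toLp u))]) (norm_nonneg _)
        exact Subtype.ext (norm_eq_zero.1 h) }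

theorem norm_def (u : BesovSpace hν s hp) :
    ‖u‖ = ‖toLp u‖ + (besovSeminorm s p ν (toLp u)).toReal := rfl

instance : NormedSpace ℝ (BesovSpace hν s hp) where
  norm_smul_le c u := by
    have : Fact (1 ≤ ENNReal.ofReal p) := ⟨by simpa using hp⟩
    rw [norm_def, norm_def, map_smul, besovSeminorm_smul hν s hp, norm_smul, ENNReal.toReal_mul,
      ENNReal.toReal_ofReal (abs_nonneg c), Real.norm_eq_abs, mul_add]

end BesovSpace

end Besov

/-!
Fix `0 < t` small. The lower Hölder bound puts `f⁻¹ B(f x, 5t)` into a ball of radius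
`(5Ct)^(1/θ₁)`, so `θ₁ QW ≤ QZ` gives `νZ (f⁻¹ B(w, 5t)) ≤ K νW (B(w, t))`, and the Vitali covering
lemma turns this into `f_* νZ ≤ K νW`. Hence composition with `f` is well defined almost everywhere
and bounded on `L^p`. The Besov seminorm is an `L^p` norm of `u x - u y` for a measure on the
product whose density is the Besov kernel. Where `dist x y < r`, the upper Hölder bound and the
condition on `s'` bound the kernel of `Z` by that of `W` at `(f x, f y)`; where `r ≤ dist x y`,
doubling makes the kernel integrable in each variable, uniformly in the other, and the `L^p` norm of
`u ∘ f` suffices.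

Injectivity is not automatic, as `νW` may charge sets with `νZ`-null preimage. It holds because the
kernel of `Z` has infinite integral near the diagonal: if `u ∘ f = 0` almost everywhere and
`u (f x) ≠ 0`, then the energy of `u` at `f x` is infinite, which happens only on a `νW`-null set.
-/

open scoped Topology

section MapLe

variable {X Y E : Type*} [MeasurableSpace X] [MeasurableSpace Y] {μ : Measure X} {ν : Measure Y}
  {φ : X → Y} {c : ℝ≥0∞}

theorem map_withDensity_le_smul_withDensity (hφ : Measurable φ) (hmap : μ.map φ ≤ c • ν)
    {k : X → ℝ≥0∞} {l : Y → ℝ≥0∞} (hl : Measurable l) {b : ℝ≥0∞}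
    (hkl : ∀ᵐ x ∂μ, k x ≤ b * l (φ x)) :
    (μ.withDensity k).map φ ≤ (b * c) • ν.withDensity l := by
  refine Measure.le_iff.2 fun s hs => ?_
  calc (μ.withDensity k).map φ s
      = ∫⁻ x in φ ⁻¹' s, k x ∂μ := by
        rw [Measure.map_apply hφ hs, withDensity_apply _ (hφ hs)]
    _ ≤ ∫⁻ x in φ ⁻¹' s, b * l (φ x) ∂μ := lintegral_mono_ae (ae_restrict_of_ae hkl)
    _ = b * ∫⁻ y in s, l y ∂(μ.map φ) := by
        rw [setLIntegral_map hs hl hφ]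
        exact lintegral_const_mul b (hl.comp hφ)
    _ ≤ b * ∫⁻ y in s, l y ∂(c • ν) := by
        gcongr
    _ = ((b * c) • ν.withDensity l) s := by
        rw [Measure.smul_apply, withDensity_apply _ hs, Measure.restrict_smul,
          lintegral_smul_measure, smul_eq_mul, smul_eq_mul, mul_assoc]

theorem map_fst_withDensity_prod_le_smul [SFinite μ] [SFinite ν] {k : X × Y → ℝ≥0∞}
    (hk : Measurable k) (hc : ∀ x, ∫⁻ y, k (x, y) ∂ν ≤ c) :
    ((μ.prod ν).withDensity k).map Prod.fst ≤ c • μ := by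
  refine Measure.le_iff.2 fun s hs => ?_
  rw [Measure.map_apply measurable_fst hs, withDensity_apply _ (measurable_fst hs),
    ← prod_univ, setLIntegral_prod _ hk.aemeasurable, Measure.smul_apply, smul_eq_mul,
    ← setLIntegral_const]
  simp only [Measure.restrict_univ]
  exact lintegral_mono hc

theorem map_snd_withDensity_prod_le_smul [SFinite μ] [SFinite ν] {k : X × Y → ℝ≥0∞}
    (hk : Measurable k) (hc : ∀ y, ∫⁻ x, k (x, y) ∂μ ≤ c) :
    ((μ.prod ν).withDensity k).map Prod.snd ≤ c • ν := by
  refine Measure.le_iff.2 fun s hs => ?_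
  rw [Measure.map_apply measurable_snd hs, withDensity_apply _ (measurable_snd hs),
    ← univ_prod, setLIntegral_prod_symm _ hk.aemeasurable, Measure.smul_apply, smul_eq_mul,
    ← setLIntegral_const]
  simp only [Measure.restrict_univ]
  exact lintegral_mono hc

theorem ae_eq_comp_of_map_le_smul (hφ : Measurable φ) (hmap : μ.map φ ≤ c • ν) {u v : Y → E}
    (h : u =ᵐ[ν] v) : u ∘ φ =ᵐ[μ] v ∘ φ :=
  ae_eq_comp hφ.aemeasurable ((Measure.absolutelyContinuous_of_le_smul hmap).ae_eq h)

variable [NormedAddCommGroup E] {q : ℝ≥0∞}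

theorem eLpNorm_comp_le_of_map_le_smul (hφ : Measurable φ) (hmap : μ.map φ ≤ c • ν) {u : Y → E}
    (hu : AEStronglyMeasurable u ν) :
    eLpNorm (u ∘ φ) q μ ≤ c ^ (1 / q).toReal * eLpNorm u q ν := by
  have hac := Measure.absolutelyContinuous_of_le_smul hmap
  rw [← eLpNorm_map_measure (hu.mono_ac hac) hφ.aemeasurable]
  exact (eLpNorm_mono_measure u hmap).trans (eLpNorm_smul_measure_le c u q ν)

/-- Composition with `φ`, as a linear map `L^q(ν) → L^q(μ)`. -/
noncomputable def lpComp (𝕜 E : Type*) [NormedAddCommGroup E] [NormedRing 𝕜] [Module 𝕜 E]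
    [IsBoundedSMul 𝕜 E] (q : ℝ≥0∞) (hφ : Measurable φ) (hc : c ≠ ∞) (hmap : μ.map φ ≤ c • ν) :
    Lp E q ν →ₗ[𝕜] Lp E q μ where
  toFun u := (((Lp.memLp u).of_measure_le_smul hc hmap).comp_of_map hφ.aemeasurable).toLp _
  map_add' u v := by
    rw [← MemLp.toLp_add, MemLp.toLp_eq_toLp_iff]
    exact ae_eq_comp_of_map_le_smul hφ hmap (Lp.coeFn_add u v)
  map_smul' a u := by
    rw [RingHom.id_apply, ← MemLp.toLp_const_smul, MemLp.toLp_eq_toLp_iff]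
    exact ae_eq_comp_of_map_le_smul hφ hmap (Lp.coeFn_smul a u)

variable {𝕜 : Type*} [NormedRing 𝕜] [Module 𝕜 E] [IsBoundedSMul 𝕜 E]

theorem coeFn_lpComp (hφ : Measurable φ) (hc : c ≠ ∞) (hmap : μ.map φ ≤ c • ν) (u : Lp E q ν) :
    lpComp 𝕜 E q hφ hc hmap u =ᵐ[μ] u ∘ φ :=
  MemLp.coeFn_toLp (((Lp.memLp u).of_measure_le_smul hc hmap).comp_of_map hφ.aemeasurable)

theorem norm_lpComp_le (hφ : Measurable φ) (hc : c ≠ ∞) (hmap : μ.map φ ≤ c • ν) (u : Lp E q ν) :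
    ‖lpComp 𝕜 E q hφ hc hmap u‖ ≤ (c ^ (1 / q).toReal).toReal * ‖u‖ := by
  rw [Lp.norm_def, Lp.norm_def, ← ENNReal.toReal_mul, eLpNorm_congr_ae (coeFn_lpComp hφ hc hmap u)]
  have hc' : c ^ (1 / q).toReal ≠ ∞ := by finiteness
  exact ENNReal.toReal_mono (ENNReal.mul_ne_top hc' (Lp.eLpNorm_ne_top u))
    (eLpNorm_comp_le_of_map_le_smul hφ hmap (Lp.aestronglyMeasurable u))

end MapLe

section Vitali

variable {X : Type*} [PseudoMetricSpace X] [SecondCountableTopology X] [MeasurableSpace X]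
  [OpensMeasurableSpace X] {μ ν : Measure X} {K : ℝ≥0∞}

/-- By the Vitali covering lemma, an open set is covered by enlargements of disjoint small balls
contained in it. -/
theorem measure_le_mul_of_eventually_measure_ball_le
    (h : ∀ x, ∀ᶠ t in 𝓝[>] 0, μ (ball x (5 * t)) ≤ K * ν (ball x t)) {U : Set X} (hU : IsOpen U) :
    μ U ≤ K * ν U := by
  have hsmall (x : U) : ∃ t : ℝ, 0 < t ∧ t ≤ 1 ∧ closedBall (x : X) t ⊆ U ∧
      μ (ball (x : X) (5 * t)) ≤ K * ν (ball (x : X) t) := by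
    obtain ⟨δ, hδ, hδU⟩ := nhds_basis_closedBall.mem_iff.1 (hU.mem_nhds x.2)
    obtain ⟨t, ht, ht0, htδ⟩ := ((h x).and
      (Ioc_mem_nhdsGT (lt_min hδ one_pos) : Ioc 0 (min δ 1) ∈ 𝓝[>] 0)).exists
    exact ⟨t, ht0, htδ.trans (min_le_right _ _),
      (closedBall_subset_closedBall (htδ.trans (min_le_left _ _))).trans hδU, ht⟩
  choose t ht0 ht1 htU hμν using hsmall
  obtain ⟨s, -, hdisj, hcov⟩ := Vitali.exists_disjoint_subfamily_covering_enlargement_closedBall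
    (univ : Set U) (fun x => (x : X)) t 1 (fun x _ => ht1 x) 4 (by norm_num)
  have hs : s.Countable := hdisj.countable_of_nonempty_interior fun x _ =>
    ⟨x, ball_subset_interior_closedBall (mem_ball_self (ht0 x))⟩
  have hcover : U ⊆ ⋃ x ∈ s, ball (x : X) (5 * t x) := fun x hx => by
    obtain ⟨y, hy, hxy⟩ := hcov ⟨x, hx⟩ (mem_univ _)
    exact mem_iUnion₂.2 ⟨y, hy, closedBall_subset_ball (by linarith [ht0 y])
      (hxy (mem_closedBall_self (ht0 _).le))⟩
  calc μ U ≤ ∑' x : s, μ (ball (x : X) (5 * t x)) :=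
        (measure_mono hcover).trans (measure_biUnion_le μ hs _)
    _ ≤ ∑' x : s, K * ν (ball (x : X) (t x)) := ENNReal.tsum_le_tsum fun x => hμν x
    _ = K * ν (⋃ x ∈ s, ball (x : X) (t x)) := by
        rw [ENNReal.tsum_mul_left, measure_biUnion hs
          (hdisj.mono_on fun x _ => ball_subset_closedBall) fun x _ => measurableSet_ball]
    _ ≤ K * ν U := by
        gcongr
        exact iUnion₂_subset fun x _ => ball_subset_closedBall.trans (htU x)

theorem le_smul_of_eventually_measure_ball_le [ν.OuterRegular] (hK : K ≠ ∞)
    (h : ∀ x, ∀ᶠ t in 𝓝[>] 0, μ (ball x (5 * t)) ≤ K * ν (ball x t)) : μ ≤ K • ν := by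
  have := Measure.OuterRegular.smul ν hK
  refine Measure.le_iff.2 fun s _ => ?_
  rw [s.measure_eq_iInf_isOpen (K • ν)]
  exact le_iInf₂ fun U hsU => le_iInf fun hU =>
    (measure_mono hsU).trans (measure_le_mul_of_eventually_measure_ball_le h hU)

end Vitali

/-- `ν` is doubling at all scales, with a constant independent of the ball; compare
`IsUnifLocDoublingMeasure`, which concerns small balls only. -/
def IsDoubling {X : Type*} [PseudoMetricSpace X] [MeasurableSpace X] (ν : Measure X) : Prop :=
  ∃ D : ℝ≥0∞, D ≠ ∞ ∧ ∀ (x : X) (t : ℝ), 0 < t → ν (ball x (2 * t)) ≤ D * ν (ball x t)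

theorem exists_ofReal_lt_two_mul_ediam_ball_subset {X : Type*} [MetricSpace X] [Nontrivial X]
    (x : X) {t : ℝ} (ht : 0 < t) :
    ∃ t', 0 < t' ∧ t' ≤ t ∧ ENNReal.ofReal t' < 2 * ediam (univ : Set X) ∧
      ball x t ⊆ ball x t' := by
  rcases lt_or_ge (ENNReal.ofReal t) (2 * ediam (univ : Set X)) with h | h
  · exact ⟨t, ht, le_rfl, h, Subset.rfl⟩
  have hpos : 0 < ediam (univ : Set X) := ediam_pos_iff.2 nontrivial_univ
  have hfin : ediam (univ : Set X) ≠ ∞ := fun htop => by simp [htop] at h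
  obtain ⟨t', ht', ht'2⟩ : ∃ t', ediam (univ : Set X) < t' ∧ t' < 2 * ediam (univ : Set X) :=
    exists_between (by rw [two_mul]; exact ENNReal.lt_add_right hfin hpos.ne')
  have ht'top := ht'2.ne_top
  refine ⟨t'.toReal, ENNReal.toReal_pos (hpos.trans ht').ne' ht'top,
    ENNReal.toReal_le_of_le_ofReal ht.le (ht'2.le.trans h), by rwa [ENNReal.ofReal_toReal ht'top],
    fun y _ => ?_⟩
  rw [mem_ball, dist_edist]
  exact (ENNReal.toReal_lt_toReal (edist_ne_top _ _) ht'top).2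
    ((edist_le_ediam_of_mem (mem_univ y) (mem_univ x)).trans_lt ht')

theorem edist_lt_two_mul_ediam {X : Type*} [MetricSpace X] {x y : X} (h : x ≠ y) :
    edist x y < 2 * ediam (univ : Set X) := by
  have hle : edist x y ≤ ediam (univ : Set X) := edist_le_ediam_of_mem (mem_univ x) (mem_univ y)
  calc edist x y < edist x y + edist x y :=
        ENNReal.lt_add_right (edist_ne_top x y) (edist_pos.2 h).ne'
    _ ≤ 2 * ediam (univ : Set X) := by
        rw [two_mul]
        exact add_le_add hle hle

namespace IsAhlforsRegular

variable {X : Type*} [MetricSpace X] [MeasurableSpace X] {ν : Measure X} {Q : ℝ}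

theorem exists_ennreal_bounds (h : IsAhlforsRegular ν Q) :
    ∃ C : ℝ≥0∞, C ≠ ∞ ∧ ∀ (x : X) (t : ℝ), 0 < t → ENNReal.ofReal t < 2 * ediam (univ : Set X) →
      ENNReal.ofReal t ^ Q ≤ C * ν (ball x t) ∧ ν (ball x t) ≤ C * ENNReal.ofReal t ^ Q := by
  obtain ⟨C, hC1, hC⟩ := h
  have hC0 : 0 < C := by linarith
  refine ⟨ENNReal.ofReal C, ENNReal.ofReal_ne_top, fun x t ht htd => ?_⟩
  obtain ⟨hlow, hup⟩ := hC x t ht htd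
  rw [ENNReal.ofReal_mul (by positivity), ENNReal.ofReal_inv_of_pos hC0,
    ENNReal.inv_mul_le_iff (ENNReal.ofReal_pos.2 hC0).ne' ENNReal.ofReal_ne_top,
    ← ENNReal.ofReal_rpow_of_pos ht] at hlow
  rw [ENNReal.ofReal_mul hC0.le, ← ENNReal.ofReal_rpow_of_pos ht] at hup
  exact ⟨hlow, hup⟩

theorem exists_edist_rpow_le_measure_ball (h : IsAhlforsRegular ν Q) (hQ : 0 < Q) :
    ∃ C : ℝ≥0∞, C ≠ ∞ ∧ ∀ x y : X, edist x y ^ Q ≤ C * ν (ball x (dist x y)) := by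
  obtain ⟨C, hC, hbounds⟩ := h.exists_ennreal_bounds
  refine ⟨C, hC, fun x y => ?_⟩
  rcases eq_or_ne x y with rfl | hxy
  · simp [ENNReal.zero_rpow_of_pos hQ]
  · rw [edist_dist]
    exact (hbounds x _ (dist_pos.2 hxy) (edist_dist x y ▸ edist_lt_two_mul_ediam hxy)).1

variable [Nontrivial X]

theorem exists_measure_ball_le (h : IsAhlforsRegular ν Q) (hQ : 0 ≤ Q) :
    ∃ C : ℝ≥0∞, C ≠ ∞ ∧ ∀ (x : X) (t : ℝ), ν (ball x t) ≤ C * ENNReal.ofReal t ^ Q := by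
  obtain ⟨C, hC, hbounds⟩ := h.exists_ennreal_bounds
  refine ⟨C, hC, fun x t => ?_⟩
  rcases le_or_gt t 0 with ht | ht
  · simp [ball_eq_empty.2 ht]
  obtain ⟨t', ht', htt', hd, hsub⟩ := exists_ofReal_lt_two_mul_ediam_ball_subset x ht
  calc ν (ball x t) ≤ ν (ball x t') := measure_mono hsub
    _ ≤ C * ENNReal.ofReal t' ^ Q := (hbounds x t' ht' hd).2
    _ ≤ C * ENNReal.ofReal t ^ Q := by gcongr

theorem isDoubling (h : IsAhlforsRegular ν Q) : IsDoubling ν := by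
  obtain ⟨C, hC, hbounds⟩ := h.exists_ennreal_bounds
  refine ⟨C * 2 ^ Q * C, by finiteness, fun x t ht => ?_⟩
  obtain ⟨t', ht', htt', hd, hsub⟩ :=
    exists_ofReal_lt_two_mul_ediam_ball_subset x (mul_pos two_pos ht)
  have hd2 : ENNReal.ofReal (t' / 2) < 2 * ediam (univ : Set X) :=
    (ENNReal.ofReal_le_ofReal (by linarith)).trans_lt hd
  have hmul : ENNReal.ofReal t' = 2 * ENNReal.ofReal (t' / 2) := by
    rw [← ENNReal.ofReal_ofNat, ← ENNReal.ofReal_mul zero_le_two]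
    congr 1
    ring
  calc ν (ball x (2 * t)) ≤ ν (ball x t') := measure_mono hsub
    _ ≤ C * ENNReal.ofReal t' ^ Q := (hbounds x t' ht' hd).2
    _ = C * 2 ^ Q * ENNReal.ofReal (t' / 2) ^ Q := by
        rw [hmul, ENNReal.mul_rpow_of_ne_top (by simp) ENNReal.ofReal_ne_top, mul_assoc]
    _ ≤ C * 2 ^ Q * (C * ν (ball x (t' / 2))) := by
        gcongr
        exact (hbounds x _ (half_pos ht') hd2).1
    _ ≤ C * 2 ^ Q * C * ν (ball x t) := by
        rw [mul_assoc _ C]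
        gcongr
        linarith

theorem isOpenPosMeasure (h : IsAhlforsRegular ν Q) : ν.IsOpenPosMeasure where
  open_pos U hU := by
    rintro ⟨x, hx⟩
    obtain ⟨t, ht, hsub⟩ := Metric.isOpen_iff.1 hU x hx
    exact ((h.measure_ball_pos x ht).trans_le (measure_mono hsub)).ne'

theorem isLocallyFiniteMeasure (h : IsAhlforsRegular ν Q) : IsLocallyFiniteMeasure ν :=
  ⟨fun x => ⟨ball x 1, ball_mem_nhds x one_pos, h.measure_ball_lt_top x 1⟩⟩

end IsAhlforsRegular

section BesovKernel

variable {X : Type*} [MetricSpace X] [MeasurableSpace X] {ν : Measure X} {s p : ℝ}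

/-- The density of `besovMeasure s p ν` with respect to `ν.prod ν`. -/
noncomputable def besovKernel (s p : ℝ) (ν : Measure X) (z : X × X) : ℝ≥0∞ :=
  (edist z.1 z.2 ^ (s * p))⁻¹ * (ν (ball z.1 (dist z.1 z.2)))⁻¹

theorem besovMeasure_eq_withDensity :
    besovMeasure s p ν = (ν.prod ν).withDensity (besovKernel s p ν) := rfl

theorem restrict_besovMeasure {S : Set (X × X)} (hS : MeasurableSet S) :
    (besovMeasure s p ν).restrict S =
      (ν.prod ν).withDensity (S.indicator (besovKernel s p ν)) := by
  rw [besovMeasure_eq_withDensity, withDensity_indicator hS, restrict_withDensity hS]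

theorem IsAhlforsRegular.besovKernel_eq_inv [Nontrivial X] {Q : ℝ} (h : IsAhlforsRegular ν Q)
    (hsp : 0 ≤ s * p) (x y : X) :
    besovKernel s p ν (x, y) = (edist x y ^ (s * p) * ν (ball x (dist x y)))⁻¹ :=
  (ENNReal.mul_inv (.inr (h.measure_ball_lt_top x _).ne)
    (.inl (ENNReal.rpow_ne_top_of_nonneg hsp (edist_ne_top x y)))).symm

theorem inv_le_mul_inv_of_le_mul {a b c : ℝ≥0∞} (hc : c ≠ 0) (hc' : c ≠ ∞) (h : b ≤ c * a) :
    a⁻¹ ≤ c * b⁻¹ := by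
  calc a⁻¹ = c * (c * a)⁻¹ := by
        rw [ENNReal.mul_inv (.inl hc) (.inl hc'), ← mul_assoc, ENNReal.mul_inv_cancel hc hc',
          one_mul]
    _ ≤ c * b⁻¹ := by gcongr

theorem IsDoubling.exists_besovKernel_swap_le (hν : IsDoubling ν) (s p : ℝ) :
    ∃ D : ℝ≥0∞, D ≠ ∞ ∧ ∀ x y : X, besovKernel s p ν (x, y) ≤ D * besovKernel s p ν (y, x) := by
  obtain ⟨D, hD, hball⟩ := hν
  refine ⟨D + 1, by finiteness, fun x y => ?_⟩
  have hle : ν (ball y (dist x y)) ≤ (D + 1) * ν (ball x (dist x y)) := by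
    rcases eq_or_ne x y with rfl | hxy
    · simp
    calc ν (ball y (dist x y)) ≤ ν (ball x (2 * dist x y)) :=
          measure_mono (ball_subset_ball' (by rw [dist_comm y x]; linarith))
      _ ≤ D * ν (ball x (dist x y)) := hball x _ (dist_pos.2 hxy)
      _ ≤ (D + 1) * ν (ball x (dist x y)) := by gcongr; exact le_self_add
  simp only [besovKernel, edist_comm y x, dist_comm y x]
  rw [mul_left_comm]
  gcongr
  exact inv_le_mul_inv_of_le_mul (by simp) (by finiteness) hle

theorem setLIntegral_besovKernel_annulus_le (hsp : 0 ≤ s * p) {D : ℝ≥0∞} {x : X} {t : ℝ}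
    (hD : ν (ball x (2 * t)) ≤ D * ν (ball x t)) :
    ∫⁻ y in {y | t ≤ dist x y ∧ dist x y < 2 * t}, besovKernel s p ν (x, y) ∂ν ≤
      D * (ENNReal.ofReal t ^ (s * p))⁻¹ := by
  set A := {y | t ≤ dist x y ∧ dist x y < 2 * t}
  have hA : A ⊆ ball x (2 * t) := fun y hy => mem_ball'.2 hy.2
  have hker : ∀ y ∈ A, besovKernel s p ν (x, y) ≤
      (ENNReal.ofReal t ^ (s * p))⁻¹ * (ν (ball x t))⁻¹ := fun y hy => by
    rw [besovKernel, edist_dist]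
    gcongr
    exacts [hy.1, hy.1]
  calc ∫⁻ y in A, besovKernel s p ν (x, y) ∂ν
      ≤ ∫⁻ _ in A, (ENNReal.ofReal t ^ (s * p))⁻¹ * (ν (ball x t))⁻¹ ∂ν :=
        setLIntegral_mono measurable_const hker
    _ = (ENNReal.ofReal t ^ (s * p))⁻¹ * (ν A / ν (ball x t)) := by
        rw [setLIntegral_const, div_eq_mul_inv, mul_assoc, mul_comm (ν A)]
    _ ≤ (ENNReal.ofReal t ^ (s * p))⁻¹ * D := by
        gcongr
        exact ENNReal.div_le_of_le_mul ((measure_mono hA).trans hD)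
    _ = D * (ENNReal.ofReal t ^ (s * p))⁻¹ := mul_comm _ _

theorem IsDoubling.exists_setLIntegral_besovKernel_le (hν : IsDoubling ν) (hsp : 0 < s * p) {r : ℝ}
    (hr : 0 < r) :
    ∃ T : ℝ≥0∞, T ≠ ∞ ∧ ∀ x, ∫⁻ y in {y | r ≤ dist x y}, besovKernel s p ν (x, y) ∂ν ≤ T := by
  obtain ⟨D, hD, hball⟩ := hν
  have hr' : (ENNReal.ofReal r ^ (s * p))⁻¹ ≠ ∞ :=
    ENNReal.inv_ne_top.2 (ENNReal.rpow_pos (ENNReal.ofReal_pos.2 hr) ENNReal.ofReal_ne_top).ne'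
  have hratio : ((2 : ℝ≥0∞) ^ (s * p))⁻¹ < 1 :=
    ENNReal.inv_lt_one.2 (ENNReal.one_lt_rpow (by norm_num) hsp)
  refine ⟨∑' j : ℕ, D * (ENNReal.ofReal r ^ (s * p))⁻¹ * ((2 ^ (s * p))⁻¹) ^ j, ?_, fun x => ?_⟩
  · rw [ENNReal.tsum_mul_left, ENNReal.tsum_geometric]
    exact ENNReal.mul_ne_top (ENNReal.mul_ne_top hD hr')
      (ENNReal.inv_ne_top.2 (tsub_pos_of_lt hratio).ne')
  have hcover : {y | r ≤ dist x y} ⊆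
      ⋃ j : ℕ, {y | 2 ^ j * r ≤ dist x y ∧ dist x y < 2 * (2 ^ j * r)} := fun y hy => by
    obtain ⟨j, hj, hj'⟩ := exists_nat_pow_near ((one_le_div hr).2 hy) one_lt_two
    rw [le_div_iff₀ hr] at hj
    rw [div_lt_iff₀ hr, pow_succ', mul_assoc] at hj'
    exact mem_iUnion.2 ⟨j, hj, hj'⟩
  refine (lintegral_mono_set hcover).trans ((lintegral_iUnion_le _ _).trans
    (ENNReal.tsum_le_tsum fun j => ?_))
  refine (setLIntegral_besovKernel_annulus_le hsp.le (hball x _ (by positivity))).trans_eq ?_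
  rw [ENNReal.ofReal_mul (by positivity), ENNReal.ofReal_pow zero_le_two, ENNReal.ofReal_ofNat,
    ENNReal.mul_rpow_of_nonneg _ _ hsp.le, ENNReal.mul_inv (by simp) (by simp),
    ← ENNReal.rpow_natCast_mul, mul_comm (j : ℝ), ENNReal.rpow_mul_natCast, ENNReal.inv_pow,
    mul_assoc, mul_comm (_ ^ j)]

variable [OpensMeasurableSpace X]

/-- For small `t` the integral over `ball x t` is at least `(t ^ (s * p))⁻¹`. -/
theorem setLIntegral_besovKernel_ball_eq_top [ν.IsOpenPosMeasure] [IsLocallyFiniteMeasure ν]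
    (hsp : 0 < s * p) (x : X) {r : ℝ} (hr : 0 < r) :
    ∫⁻ y in ball x r, besovKernel s p ν (x, y) ∂ν = ∞ := by
  have hlow : ∀ᶠ t : ℝ in 𝓝[>] 0, (ENNReal.ofReal t ^ (s * p))⁻¹ ≤
      ∫⁻ y in ball x r, besovKernel s p ν (x, y) ∂ν := by
    obtain ⟨ε, hε, hfin⟩ := (ν.finiteAt_nhds x).exists_mem_basis nhds_basis_ball
    filter_upwards [Ioc_mem_nhdsGT (lt_min hε hr)] with t ht
    have hball0 : ν (ball x t) ≠ 0 := (measure_ball_pos ν x ht.1).ne'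
    have hball : ν (ball x t) ≠ ∞ :=
      ((measure_mono (ball_subset_ball (ht.2.trans (min_le_left _ _)))).trans_lt hfin).ne
    calc (ENNReal.ofReal t ^ (s * p))⁻¹
        = ∫⁻ _ in ball x t, (ENNReal.ofReal t ^ (s * p))⁻¹ * (ν (ball x t))⁻¹ ∂ν := by
          rw [setLIntegral_const, mul_assoc, ENNReal.inv_mul_cancel hball0 hball, mul_one]
      _ ≤ ∫⁻ y in ball x t, besovKernel s p ν (x, y) ∂ν := by
          refine setLIntegral_mono' measurableSet_ball fun y hy => ?_
          rw [mem_ball'] at hy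
          rw [besovKernel, edist_dist]
          gcongr
      _ ≤ ∫⁻ y in ball x r, besovKernel s p ν (x, y) ∂ν :=
          lintegral_mono_set (ball_subset_ball (ht.2.trans (min_le_right _ _)))
  have hlim : Filter.Tendsto (fun t : ℝ => (ENNReal.ofReal t ^ (s * p))⁻¹) (𝓝[>] 0) (𝓝 ∞) := by
    have hcont : Continuous fun t : ℝ => (ENNReal.ofReal t ^ (s * p))⁻¹ :=
      ((ENNReal.continuous_rpow_const).comp ENNReal.continuous_ofReal).inv
    simpa [ENNReal.zero_rpow_of_pos hsp] using (hcont.tendsto 0).mono_left nhdsWithin_le_nhds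
  exact top_unique (le_of_tendsto hlim hlow)

end BesovKernel

section BesovMeasure

variable {X : Type*} [MetricSpace X] [MeasurableSpace X] [BorelSpace X]
  [SecondCountableTopology X] {ν : Measure X} [SFinite ν] {s p : ℝ}

theorem measurable_besovKernel : Measurable (besovKernel s p ν) := by
  have hball : Measurable fun z : X × X => ν (ball z.1 (dist z.1 z.2)) :=
    measurable_measure_prodMk_left
      (measurableSet_lt (by fun_prop) (by fun_prop) :
        MeasurableSet {q : (X × X) × X | dist q.2 q.1.1 < dist q.1.1 q.1.2})
  exact (Measurable.pow_const (by fun_prop) _).inv.mul hball.inv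

theorem ae_lintegral_besovKernel_ne_top (hp : 1 ≤ p) {u : X → ℝ} (hu : Measurable u)
    (hfin : besovSeminorm s p ν u ≠ ∞) :
    ∀ᵐ x ∂ν, ∫⁻ y, ‖u x - u y‖ₑ ^ p * besovKernel s p ν (x, y) ∂ν ≠ ∞ := by
  have hp0 : 0 < p := by linarith
  have hm : Measurable fun z : X × X => ‖u z.1 - u z.2‖ₑ ^ p * besovKernel s p ν z :=
    Measurable.mul (by fun_prop) measurable_besovKernel
  have hint : ∫⁻ z, ‖u z.1 - u z.2‖ₑ ^ p * besovKernel s p ν z ∂(ν.prod ν) < ∞ := by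
    rw [besovSeminorm_eq s hp hu] at hfin
    have := lintegral_rpow_enorm_lt_top_of_eLpNorm_lt_top (by simpa using hp0)
      ENNReal.ofReal_ne_top hfin.lt_top
    rw [ENNReal.toReal_ofReal hp0.le, besovMeasure_eq_withDensity,
      lintegral_withDensity_eq_lintegral_mul _ measurable_besovKernel (by fun_prop)] at this
    simpa only [Pi.mul_apply, mul_comm] using this
  rw [lintegral_prod _ hm.aemeasurable] at hint
  filter_upwards [ae_lt_top hm.lintegral_prod_right' hint.ne] with x hx using hx.ne

theorem IsDoubling.exists_map_restrict_besovMeasure_le_smul (hν : IsDoubling ν) (hsp : 0 < s * p)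
    {r : ℝ} (hr : 0 < r) :
    ∃ T : ℝ≥0∞, T ≠ ∞ ∧
      ((besovMeasure s p ν).restrict {z | r ≤ dist z.1 z.2}).map Prod.fst ≤ T • ν ∧
      ((besovMeasure s p ν).restrict {z | r ≤ dist z.1 z.2}).map Prod.snd ≤ T • ν := by
  obtain ⟨T, hT, htail⟩ := hν.exists_setLIntegral_besovKernel_le hsp hr
  obtain ⟨D, hD, hswap⟩ := hν.exists_besovKernel_swap_le s p
  set S : Set (X × X) := {z | r ≤ dist z.1 z.2}
  have hS : MeasurableSet S := measurableSet_le measurable_const (by fun_prop)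
  have hk : Measurable (S.indicator (besovKernel s p ν)) := measurable_besovKernel.indicator hS
  have htail' (x : X) : ∫⁻ y, S.indicator (besovKernel s p ν) (x, y) ∂ν ≤ T :=
    (lintegral_indicator (measurable_prodMk_left hS) _).trans_le (htail x)
  have hswap' (x y : X) : S.indicator (besovKernel s p ν) (x, y) ≤
      D * S.indicator (besovKernel s p ν) (y, x) := by
    by_cases hxy : r ≤ dist x y
    · simpa [S, indicator, hxy, dist_comm y x] using hswap x y
    · simp [S, indicator, hxy]
  rw [restrict_besovMeasure hS]
  refine ⟨max T (D * T), by finiteness, map_fst_withDensity_prod_le_smul hk fun x =>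
    (htail' x).trans (le_max_left _ _), map_snd_withDensity_prod_le_smul hk fun y => ?_⟩
  calc ∫⁻ x, S.indicator (besovKernel s p ν) (x, y) ∂ν
      ≤ ∫⁻ x, D * S.indicator (besovKernel s p ν) (y, x) ∂ν := lintegral_mono (hswap' · y)
    _ = D * ∫⁻ x, S.indicator (besovKernel s p ν) (y, x) ∂ν := lintegral_const_mul' _ _ hD
    _ ≤ D * T := by
        gcongr
        exact htail' y
    _ ≤ max T (D * T) := le_max_right _ _

variable {E : Type*} [NormedAddCommGroup E] {q : ℝ≥0∞}

theorem IsDoubling.exists_eLpNorm_sub_restrict_besovMeasure_le (hν : IsDoubling ν)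
    (hsp : 0 < s * p) (hq : 1 ≤ q) {r : ℝ} (hr : 0 < r) :
    ∃ T : ℝ≥0∞, T ≠ ∞ ∧ ∀ u : X → E, AEStronglyMeasurable u ν →
      eLpNorm (fun z => u z.1 - u z.2) q
        ((besovMeasure s p ν).restrict {z | r ≤ dist z.1 z.2}) ≤ T * eLpNorm u q ν := by
  obtain ⟨T, hT, hfst, hsnd⟩ := hν.exists_map_restrict_besovMeasure_le_smul hsp hr
  have hmeas {φ : X × X → X} (hφ : Measurable φ) {μ : Measure (X × X)} (hmap : μ.map φ ≤ T • ν)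
      {u : X → E} (hu : AEStronglyMeasurable u ν) : AEStronglyMeasurable (u ∘ φ) μ :=
    (hu.mono_ac (Measure.absolutelyContinuous_of_le_smul hmap)).comp_measurable hφ
  refine ⟨T ^ (1 / q).toReal + T ^ (1 / q).toReal, by finiteness, fun u hu => ?_⟩
  refine (eLpNorm_sub_le (hmeas measurable_fst hfst hu) (hmeas measurable_snd hsnd hu) hq).trans ?_
  rw [add_mul]
  exact add_le_add (eLpNorm_comp_le_of_map_le_smul measurable_fst hfst hu)
    (eLpNorm_comp_le_of_map_le_smul measurable_snd hsnd hu)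

end BesovMeasure

section Composition

theorem eLpNorm_le_restrict_add_restrict_compl {X E : Type*} [MeasurableSpace X]
    [NormedAddCommGroup E] {μ : Measure X} {q : ℝ≥0∞} (hq : 1 ≤ q) {u : X → E}
    (hu : AEStronglyMeasurable u μ) {S : Set X} (hS : MeasurableSet S) :
    eLpNorm u q μ ≤ eLpNorm u q (μ.restrict S) + eLpNorm u q (μ.restrict Sᶜ) := by
  rw [← eLpNorm_indicator_eq_eLpNorm_restrict hS,
    ← eLpNorm_indicator_eq_eLpNorm_restrict hS.compl]
  conv_lhs => rw [← indicator_self_add_compl S u]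
  exact eLpNorm_add_le (hu.indicator hS) (hu.indicator hS.compl) hq

variable {X Y : Type*} [MetricSpace X] [MeasurableSpace X] [BorelSpace X]
  [MetricSpace Y] [MeasurableSpace Y] [BorelSpace Y]
  [SecondCountableTopology Y] {μ : Measure X} {ν : Measure Y} [SFinite ν]
  {s s' p r : ℝ} {f : X → Y} {b c : ℝ≥0∞}

theorem ae_eq_zero_of_comp_ae_eq_zero [μ.IsOpenPosMeasure] [IsLocallyFiniteMeasure μ]
    (hs' : 0 < s' * p) (hp : 1 ≤ p) (hr : 0 < r) (hf : Measurable f)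
    (hsurj : Function.Surjective f) (hc : c ≠ ∞) (hmap : μ.map f ≤ c • ν) (hb : b ≠ ∞)
    (hker : ∀ x y, dist x y < r →
      besovKernel s' p μ (x, y) ≤ b * besovKernel s p ν (f x, f y))
    {u : Y → ℝ} (hu : Measurable u) (hfin : besovSeminorm s p ν u ≠ ∞) (h : u ∘ f =ᵐ[μ] 0) :
    u =ᵐ[ν] 0 := by
  filter_upwards [ae_lintegral_besovKernel_ne_top hp hu hfin] with y hy
  obtain ⟨x, rfl⟩ := hsurj y
  by_contra! hx
  refine hy ?_
  set F : Y → ℝ≥0∞ := fun y => ‖u (f x) - u y‖ₑ ^ p * besovKernel s p ν (f x, y)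
  have hF : Measurable F :=
    Measurable.mul (by fun_prop) (measurable_besovKernel.comp measurable_prodMk_left)
  have htop : ∫⁻ z in ball x r, ‖u (f x)‖ₑ ^ p * besovKernel s' p μ (x, z) ∂μ = ∞ := by
    rw [lintegral_const_mul' _ _ (ENNReal.rpow_ne_top_of_nonneg (by linarith) enorm_ne_top),
      setLIntegral_besovKernel_ball_eq_top hs' x hr, ENNReal.mul_top]
    exact (ENNReal.rpow_pos (enorm_pos.2 hx) enorm_ne_top).ne'
  have hle : ∫⁻ z in ball x r, ‖u (f x)‖ₑ ^ p * besovKernel s' p μ (x, z) ∂μ ≤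
      b * (c * ∫⁻ y, F y ∂ν) := by
    calc ∫⁻ z in ball x r, ‖u (f x)‖ₑ ^ p * besovKernel s' p μ (x, z) ∂μ
        ≤ ∫⁻ z in ball x r, b * F (f z) ∂μ := by
          refine setLIntegral_mono_ae' measurableSet_ball ?_
          filter_upwards [h] with z hz hzr
          simp only [Function.comp_apply, Pi.zero_apply] at hz
          simp only [F, hz, sub_zero, mul_left_comm b]
          gcongr
          exact hker x z (mem_ball'.1 hzr)
      _ ≤ ∫⁻ z, b * F (f z) ∂μ := setLIntegral_le_lintegral _ _
      _ = b * ∫⁻ y, F y ∂(μ.map f) := by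
          rw [lintegral_const_mul' _ _ hb, lintegral_map hF hf]
      _ ≤ b * ∫⁻ y, F y ∂(c • ν) := by gcongr
      _ = b * (c * ∫⁻ y, F y ∂ν) := by rw [lintegral_smul_measure, smul_eq_mul]
  by_contra hne
  exact (ENNReal.mul_ne_top hb (ENNReal.mul_ne_top hc hne)) (top_unique (htop ▸ hle))

variable [SecondCountableTopology X] [SFinite μ]

theorem map_restrict_besovMeasure_le_smul (hf : Measurable f)
    (hmap : μ.map f ≤ c • ν) (hker : ∀ x y, dist x y < r →
      besovKernel s' p μ (x, y) ≤ b * besovKernel s p ν (f x, f y)) :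
    ((besovMeasure s' p μ).restrict {z | dist z.1 z.2 < r}).map (Prod.map f f) ≤
      (b * (c * c)) • besovMeasure s p ν := by
  have hS : MeasurableSet {z : X × X | dist z.1 z.2 < r} :=
    measurableSet_lt (by fun_prop) measurable_const
  have hprod : (μ.prod μ).map (Prod.map f f) ≤ (c * c) • ν.prod ν := by
    have : SFinite (c • ν) := inferInstance
    calc (μ.prod μ).map (Prod.map f f) = (μ.map f).prod (μ.map f) :=
          (Measure.map_prod_map _ _ hf hf).symm
      _ ≤ (c • ν).prod (c • ν) := Measure.prod_mono hmap hmap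
      _ = (c * c) • ν.prod ν := by
          rw [Measure.prod_smul_left, Measure.prod_smul_right, smul_smul]
  rw [restrict_besovMeasure hS, besovMeasure_eq_withDensity]
  refine map_withDensity_le_smul_withDensity (hf.prodMap hf) hprod measurable_besovKernel
    (.of_forall fun z => ?_)
  exact indicator_le (fun z hz => hker z.1 z.2 hz) z

theorem eLpNorm_sub_comp_restrict_besovMeasure_le {E : Type*} [NormedAddCommGroup E]
    (q : ℝ≥0∞) (hf : Measurable f) (hmap : μ.map f ≤ c • ν) (hker : ∀ x y, dist x y < r →
      besovKernel s' p μ (x, y) ≤ b * besovKernel s p ν (f x, f y))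
    {u : Y → E} (hu : StronglyMeasurable u) :
    eLpNorm (fun z => u (f z.1) - u (f z.2)) q
        ((besovMeasure s' p μ).restrict {z | dist z.1 z.2 < r}) ≤
      (b * (c * c)) ^ (1 / q).toReal * eLpNorm (fun z => u z.1 - u z.2) q (besovMeasure s p ν) :=
  eLpNorm_comp_le_of_map_le_smul (u := fun z => u z.1 - u z.2) (hf.prodMap hf)
    (map_restrict_besovMeasure_le_smul hf hmap hker)
    ((hu.comp_measurable measurable_fst).sub
      (hu.comp_measurable measurable_snd)).aestronglyMeasurable

theorem exists_besovSeminorm_comp_le (hμ : IsDoubling μ) (hs' : 0 < s' * p) (hp : 1 ≤ p)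
    (hr : 0 < r) (hf : Measurable f) (hc : c ≠ ∞) (hmap : μ.map f ≤ c • ν) (hb : b ≠ ∞)
    (hker : ∀ x y, dist x y < r →
      besovKernel s' p μ (x, y) ≤ b * besovKernel s p ν (f x, f y)) :
    ∃ M : ℝ≥0∞, M ≠ ∞ ∧ ∀ u : Y → ℝ, Measurable u → besovSeminorm s' p μ (u ∘ f) ≤
      M * (eLpNorm u (ENNReal.ofReal p) ν + besovSeminorm s p ν u) := by
  set q := ENNReal.ofReal p
  have hq : 1 ≤ q := ENNReal.one_le_ofReal.2 hp
  obtain ⟨T, hT, hfar⟩ := hμ.exists_eLpNorm_sub_restrict_besovMeasure_le (E := ℝ) hs' hq hr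
  have hnear : MeasurableSet {z : X × X | dist z.1 z.2 < r} :=
    measurableSet_lt (by fun_prop) measurable_const
  have hcompl : {z : X × X | dist z.1 z.2 < r}ᶜ = {z | r ≤ dist z.1 z.2} := by
    ext
    simp
  refine ⟨(b * (c * c)) ^ (1 / q).toReal + T * c ^ (1 / q).toReal, by finiteness, fun u hu => ?_⟩
  have huf : Measurable (u ∘ f) := hu.comp hf
  set d : X × X → ℝ := fun z => (u ∘ f) z.1 - (u ∘ f) z.2
  have hd : Measurable d := by fun_prop
  calc besovSeminorm s' p μ (u ∘ f)
      = eLpNorm d q (besovMeasure s' p μ) := besovSeminorm_eq s' hp huf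
    _ ≤ eLpNorm d q ((besovMeasure s' p μ).restrict {z | dist z.1 z.2 < r}) +
          eLpNorm d q ((besovMeasure s' p μ).restrict {z | r ≤ dist z.1 z.2}) := by
        rw [← hcompl]
        exact eLpNorm_le_restrict_add_restrict_compl hq hd.aestronglyMeasurable hnear
    _ ≤ (b * (c * c)) ^ (1 / q).toReal * besovSeminorm s p ν u + T * eLpNorm (u ∘ f) q μ := by
        rw [besovSeminorm_eq s hp hu]
        exact add_le_add
          (eLpNorm_sub_comp_restrict_besovMeasure_le q hf hmap hker hu.stronglyMeasurable)
          (hfar (u ∘ f) huf.aestronglyMeasurable)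
    _ ≤ (b * (c * c)) ^ (1 / q).toReal * besovSeminorm s p ν u +
          T * (c ^ (1 / q).toReal * eLpNorm u q ν) := by
        gcongr
        exact eLpNorm_comp_le_of_map_le_smul hf hmap hu.aestronglyMeasurable
    _ ≤ ((b * (c * c)) ^ (1 / q).toReal + T * c ^ (1 / q).toReal) *
          (eLpNorm u q ν + besovSeminorm s p ν u) := by
        rw [← mul_assoc T, add_mul]
        gcongr
        exacts [le_add_self, le_self_add]

end Composition

namespace BesovSpace

variable {X Y : Type*} [MetricSpace X] [MeasurableSpace X] [BorelSpace X] [Nontrivial X]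
  [MetricSpace Y] [MeasurableSpace Y] [BorelSpace Y] [Nontrivial Y]
  {μ : Measure X} {ν : Measure Y} {QX QY s s' p : ℝ} {f : X → Y} {c M : ℝ≥0∞}

/-- Composition with `f`, as a bounded linear map `B^s_{p,p}(Y) → B^{s'}_{p,p}(X)`. -/
noncomputable def comp (hX : IsAhlforsRegular μ QX) (hY : IsAhlforsRegular ν QY) (hp : 1 ≤ p)
    (hf : Measurable f) (hc : c ≠ ∞) (hmap : μ.map f ≤ c • ν) (hM : M ≠ ∞)
    (hsemi : ∀ u : Y → ℝ, Measurable u → besovSeminorm s' p μ (u ∘ f) ≤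
      M * (eLpNorm u (ENNReal.ofReal p) ν + besovSeminorm s p ν u)) :
    BesovSpace hY s hp →L[ℝ] BesovSpace hX s' hp :=
  let L := lpComp ℝ ℝ (ENNReal.ofReal p) hf hc hmap
  have hL (u : BesovSpace hY s hp) : besovSeminorm s' p μ (L (toLp u)) ≤
      M * (eLpNorm (toLp u) (ENNReal.ofReal p) ν + besovSeminorm s p ν (toLp u)) := by
    rw [besovSeminorm_congr (coeFn_lpComp (𝕜 := ℝ) hf hc hmap _)]
    exact hsemi _ (Lp.stronglyMeasurable _).measurable
  have hfin (u : BesovSpace hY s hp) :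
      M * (eLpNorm (toLp u) (ENNReal.ofReal p) ν + besovSeminorm s p ν (toLp u)) ≠ ∞ :=
    ENNReal.mul_ne_top hM
      (ENNReal.add_ne_top.2 ⟨Lp.eLpNorm_ne_top _, seminorm_toLp_ne_top u⟩)
  let T : BesovSpace hY s hp →ₗ[ℝ] BesovSpace hX s' hp :=
    LinearMap.codRestrict (besovSubmodule hX s' hp) (L ∘ₗ toLp) fun u =>
      (hL u).trans_lt (hfin u).lt_top
  T.mkContinuous ((c ^ (1 / ENNReal.ofReal p).toReal).toReal + M.toReal) fun u => by
    have hnorm : ‖toLp u‖ ≤ ‖u‖ := le_add_of_nonneg_right ENNReal.toReal_nonneg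
    have hsemi' : (besovSeminorm s' p μ (L (toLp u))).toReal ≤ M.toReal * ‖u‖ := by
      rw [norm_def, Lp.norm_def, ← ENNReal.toReal_add (Lp.eLpNorm_ne_top _)
        (seminorm_toLp_ne_top u), ← ENNReal.toReal_mul]
      exact ENNReal.toReal_mono (hfin u) (hL u)
    calc ‖T u‖ = ‖L (toLp u)‖ + (besovSeminorm s' p μ (L (toLp u))).toReal := norm_def _
      _ ≤ (c ^ (1 / ENNReal.ofReal p).toReal).toReal * ‖u‖ + M.toReal * ‖u‖ := by
          refine add_le_add ((norm_lpComp_le hf hc hmap _).trans ?_) hsemi'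
          gcongr
      _ = ((c ^ (1 / ENNReal.ofReal p).toReal).toReal + M.toReal) * ‖u‖ := (add_mul _ _ _).symm

theorem coeFn_toLp_comp (hX : IsAhlforsRegular μ QX) (hY : IsAhlforsRegular ν QY) (hp : 1 ≤ p)
    (hf : Measurable f) (hc : c ≠ ∞) (hmap : μ.map f ≤ c • ν) (hM : M ≠ ∞)
    (hsemi : ∀ u : Y → ℝ, Measurable u → besovSeminorm s' p μ (u ∘ f) ≤
      M * (eLpNorm u (ENNReal.ofReal p) ν + besovSeminorm s p ν u))
    (u : BesovSpace hY s hp) :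
    toLp (comp hX hY hp hf hc hmap hM hsemi u) =ᵐ[μ] toLp u ∘ f :=
  coeFn_lpComp (𝕜 := ℝ) hf hc hmap (toLp u)

theorem comp_injective {b : ℝ≥0∞} {r : ℝ} (hX : IsAhlforsRegular μ QX)
    (hY : IsAhlforsRegular ν QY) (hp : 1 ≤ p) (hf : Measurable f) (hc : c ≠ ∞)
    (hmap : μ.map f ≤ c • ν) (hM : M ≠ ∞)
    (hsemi : ∀ u : Y → ℝ, Measurable u → besovSeminorm s' p μ (u ∘ f) ≤
      M * (eLpNorm u (ENNReal.ofReal p) ν + besovSeminorm s p ν u))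
    (hs' : 0 < s' * p) (hr : 0 < r) (hsurj : Function.Surjective f) (hb : b ≠ ∞)
    (hker : ∀ x y, dist x y < r →
      besovKernel s' p μ (x, y) ≤ b * besovKernel s p ν (f x, f y)) :
    Function.Injective (comp hX hY hp hf hc hmap hM hsemi) := by
  have := hX.isOpenPosMeasure
  have := hX.isLocallyFiniteMeasure
  have := hY.sigmaFinite
  have := hY.secondCountableTopology
  refine (injective_iff_map_eq_zero _).2 fun u hu => ?_
  have hcomp : toLp u ∘ f =ᵐ[μ] 0 := by
    refine (coeFn_toLp_comp hX hY hp hf hc hmap hM hsemi u).symm.trans ?_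
    rw [hu, map_zero]
    exact Lp.coeFn_zero _ _ _
  have hzero : toLp u =ᵐ[ν] 0 :=
    ae_eq_zero_of_comp_ae_eq_zero hs' hp hr hf hsurj hc hmap hb hker
      (Lp.stronglyMeasurable _).measurable (seminorm_toLp_ne_top u) hcomp
  exact Subtype.ext (Lp.eq_zero_iff_ae_eq_zero.2 hzero)

end BesovSpace

namespace IsLocallyBiHolder

variable {Z W : Type*} [MetricSpace Z] [MetricSpace W] {f : Z ≃ₜ W} {θ₁ θ₂ r : ℝ}

theorem exists_preimage_ball_subset (hf : IsLocallyBiHolder f θ₁ θ₂ r) (hr : 0 < r)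
    (hθ₁ : 0 < θ₁) :
    ∃ C : ℝ, 0 < C ∧ ∀ x, ∃ ε > 0, ∀ t < ε, f ⁻¹' ball (f x) t ⊆ ball x ((C * t) ^ θ₁⁻¹) := by
  obtain ⟨C, hC1, hC⟩ := hf
  have hC0 : 0 < C := by linarith
  refine ⟨C, hC0, fun x => ?_⟩
  obtain ⟨ε, hε, hεr⟩ := Metric.mem_nhds_iff.1
    ((f.isOpenMap _ isOpen_ball).mem_nhds (mem_image_of_mem f (mem_ball_self hr : x ∈ ball x r)))
  refine ⟨ε, hε, fun t ht y hy => ?_⟩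
  rw [mem_preimage, mem_ball] at hy
  have hyr : dist y x < r := (f.injective.mem_set_image).1 (hεr (hy.trans ht))
  have hlow : dist y x ^ θ₁ ≤ C * dist (f y) (f x) := (inv_mul_le_iff₀ hC0).1 (hC y x hyr).1
  have ht0 : 0 < t := dist_nonneg.trans_lt hy
  rw [mem_ball, Real.lt_rpow_inv_iff_of_pos dist_nonneg (by positivity) hθ₁]
  exact hlow.trans_lt (by gcongr)

variable [MeasurableSpace Z] [MeasurableSpace W] [Nontrivial W] {νZ : Measure Z}
  {νW : Measure W} {QZ QW : ℝ}

theorem exists_map_le_smul [Nontrivial Z] [BorelSpace Z] [BorelSpace W]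
    (hf : IsLocallyBiHolder f θ₁ θ₂ r) (hr : 0 < r) (hQZ : 0 ≤ QZ) (hθ₁ : 0 < θ₁)
    (hQ : θ₁ * QW ≤ QZ) (hZ : IsAhlforsRegular νZ QZ) (hW : IsAhlforsRegular νW QW) :
    ∃ K : ℝ≥0∞, K ≠ ∞ ∧ νZ.map f ≤ K • νW := by
  have := hW.secondCountableTopology
  have := hW.isLocallyFiniteMeasure
  obtain ⟨C, hC0, hC⟩ := hf.exists_preimage_ball_subset hr hθ₁
  obtain ⟨CZ, hCZ, hupper⟩ := hZ.exists_measure_ball_le hQZ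
  obtain ⟨CW, hCW, hbounds⟩ := hW.exists_ennreal_bounds
  set β := θ₁⁻¹ * QZ
  have hβ : 0 ≤ β := by positivity
  have hQWβ : QW ≤ β := (le_inv_mul_iff₀ hθ₁).2 hQ
  have hK : CZ * ENNReal.ofReal (C * 5) ^ β * CW ≠ ∞ := by finiteness
  refine ⟨_, hK, le_smul_of_eventually_measure_ball_le hK fun w => ?_⟩
  obtain ⟨x, rfl⟩ := f.surjective w
  obtain ⟨ε, hε, hsub⟩ := hC x
  have hdiam : ∀ᶠ t : ℝ in 𝓝[>] 0, ENNReal.ofReal t < 2 * ediam (univ : Set W) := by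
    refine (ENNReal.continuous_ofReal.tendsto 0).mono_left nhdsWithin_le_nhds
      |>.eventually_lt_const ?_
    simpa using ediam_pos_iff.2 (nontrivial_univ (α := W))
  filter_upwards [hdiam, Ioo_mem_nhdsGT (lt_min one_pos (by positivity : 0 < ε / 5))]
    with t htd ⟨ht0, ht⟩
  obtain ⟨ht1, htε⟩ := lt_min_iff.1 ht
  calc νZ.map f (ball (f x) (5 * t))
      = νZ (f ⁻¹' ball (f x) (5 * t)) :=
        Measure.map_apply f.continuous.measurable measurableSet_ball
    _ ≤ νZ (ball x ((C * (5 * t)) ^ θ₁⁻¹)) := measure_mono (hsub _ (by linarith))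
    _ ≤ CZ * ENNReal.ofReal ((C * (5 * t)) ^ θ₁⁻¹) ^ QZ := hupper _ _
    _ = CZ * ENNReal.ofReal (C * 5) ^ β * ENNReal.ofReal t ^ β := by
        rw [← ENNReal.ofReal_rpow_of_pos (by positivity), ← ENNReal.rpow_mul, ← mul_assoc C,
          ENNReal.ofReal_mul (by positivity), ENNReal.mul_rpow_of_nonneg _ _ hβ, mul_assoc]
    _ ≤ CZ * ENNReal.ofReal (C * 5) ^ β * (CW * νW (ball (f x) t)) := by
        gcongr
        exact (ENNReal.rpow_le_rpow_of_exponent_ge (by simpa using ht1.le) hQWβ).trans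
          (hbounds (f x) t ht0 htd).1
    _ = CZ * ENNReal.ofReal (C * 5) ^ β * CW * νW (ball (f x) t) := (mul_assoc _ _ _).symm

variable {s s' p : ℝ}

theorem exists_edist_rpow_mul_measure_ball_le (hf : IsLocallyBiHolder f θ₁ θ₂ r)
    (hZ : IsAhlforsRegular νZ QZ) (hW : IsAhlforsRegular νW QW) (hQZ : 0 < QZ) (hQW : 0 ≤ QW)
    (hsp : 0 ≤ s * p) (hsp' : 0 ≤ s' * p) (hexp : s' * p + QZ ≤ θ₂ * (s * p + QW)) :
    ∃ K : ℝ≥0∞, K ≠ ∞ ∧ ∀ x y, dist x y < r →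
      edist (f x) (f y) ^ (s * p) * νW (ball (f x) (dist (f x) (f y))) ≤
        K * (edist x y ^ (s' * p) * νZ (ball x (dist x y))) := by
  obtain ⟨C, hC1, hC⟩ := hf
  have hC0 : 0 ≤ C := by linarith
  obtain ⟨CZ, hCZ, hlower⟩ := hZ.exists_edist_rpow_le_measure_ball hQZ
  obtain ⟨CW, hCW, hupper⟩ := hW.exists_measure_ball_le hQW
  obtain ⟨γ, hγ, hγexp⟩ : ∃ γ, 0 ≤ γ ∧ θ₂ * (s * p + QW) = γ + (s' * p + QZ) :=
    ⟨_, sub_nonneg.2 hexp, (sub_add_cancel _ _).symm⟩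
  refine ⟨CW * ENNReal.ofReal C ^ (s * p + QW) * ENNReal.ofReal r ^ γ * CZ,
    by finiteness, fun x y hxy => ?_⟩
  have hθ₂ : 0 < θ₂ := pos_of_mul_pos_left (by linarith : 0 < θ₂ * (s * p + QW)) (by positivity)
  have hdist : edist (f x) (f y) ≤ ENNReal.ofReal C * edist x y ^ θ₂ := by
    rw [edist_dist, edist_dist, ENNReal.ofReal_rpow_of_nonneg dist_nonneg hθ₂.le,
      ← ENNReal.ofReal_mul hC0]
    exact ENNReal.ofReal_le_ofReal (hC x y hxy).2
  have hsplit : (edist x y ^ θ₂) ^ (s * p + QW) =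
      edist x y ^ γ * (edist x y ^ (s' * p) * edist x y ^ QZ) := by
    rw [← ENNReal.rpow_mul, hγexp, ENNReal.rpow_add_of_nonneg _ _ hγ (by positivity),
      ENNReal.rpow_add_of_nonneg _ _ hsp' hQZ.le]
  calc edist (f x) (f y) ^ (s * p) * νW (ball (f x) (dist (f x) (f y)))
      ≤ edist (f x) (f y) ^ (s * p) * (CW * edist (f x) (f y) ^ QW) := by
        rw [edist_dist (f x)]
        gcongr
        exact hupper _ _
    _ = CW * edist (f x) (f y) ^ (s * p + QW) := by
        rw [ENNReal.rpow_add_of_nonneg _ _ hsp hQW, mul_left_comm]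
    _ ≤ CW * (ENNReal.ofReal C * edist x y ^ θ₂) ^ (s * p + QW) := by gcongr
    _ = CW * ENNReal.ofReal C ^ (s * p + QW) * edist x y ^ γ *
          (edist x y ^ (s' * p) * edist x y ^ QZ) := by
        rw [ENNReal.mul_rpow_of_nonneg _ _ (by positivity), hsplit]
        ring
    _ ≤ CW * ENNReal.ofReal C ^ (s * p + QW) * ENNReal.ofReal r ^ γ *
          (edist x y ^ (s' * p) * (CZ * νZ (ball x (dist x y)))) := by
        gcongr
        · exact edist_dist x y ▸ ENNReal.ofReal_le_ofReal hxy.le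
        · exact hlower x y
    _ = CW * ENNReal.ofReal C ^ (s * p + QW) * ENNReal.ofReal r ^ γ * CZ *
          (edist x y ^ (s' * p) * νZ (ball x (dist x y))) := by ring

theorem exists_besovKernel_le [Nontrivial Z] (hf : IsLocallyBiHolder f θ₁ θ₂ r)
    (hZ : IsAhlforsRegular νZ QZ) (hW : IsAhlforsRegular νW QW) (hQZ : 0 < QZ) (hQW : 0 ≤ QW)
    (hsp : 0 ≤ s * p) (hsp' : 0 ≤ s' * p) (hexp : s' * p + QZ ≤ θ₂ * (s * p + QW)) :
    ∃ K : ℝ≥0∞, K ≠ ∞ ∧ ∀ x y, dist x y < r →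
      besovKernel s' p νZ (x, y) ≤ K * besovKernel s p νW (f x, f y) := by
  obtain ⟨K, hK, hle⟩ := hf.exists_edist_rpow_mul_measure_ball_le hZ hW hQZ hQW hsp hsp' hexp
  refine ⟨K + 1, by finiteness, fun x y hxy => ?_⟩
  rw [hZ.besovKernel_eq_inv hsp', hW.besovKernel_eq_inv hsp]
  refine inv_le_mul_inv_of_le_mul (by simp) (by finiteness) ((hle x y hxy).trans ?_)
  gcongr
  exact le_self_add

end IsLocallyBiHolder

theorem theorem1p1 {Z W : Type*}
    [MetricSpace Z] [MeasurableSpace Z] [BorelSpace Z] [Nontrivial Z]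
    [MetricSpace W] [MeasurableSpace W] [BorelSpace W] [Nontrivial W]
    (νZ : Measure Z) (νW : Measure W) (QZ QW : ℝ) (hQZ : 0 < QZ) (hQW : 0 < QW)
    (hZ : IsAhlforsRegular νZ QZ) (hW : IsAhlforsRegular νW QW)
    (θ₁ θ₂ s s' p : ℝ) (hθ₁ : 0 < θ₁) (hθ₂ : 0 < θ₂) (hs : 0 < s) (hs' : 0 < s') (hp : 1 ≤ p)
    (hQ : θ₁ * QW ≤ QZ) (hss' : s' ≤ θ₂ * s + (θ₂ * QW - QZ) / p)
    (r : ℝ) (hr : 0 < r) (hr' : ENNReal.ofReal r < 2 * ediam (univ : Set Z))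
    (f : Z ≃ₜ W) (hf : IsLocallyBiHolder f θ₁ θ₂ r) :
    ∃ T : BesovSpace hW s hp →L[ℝ] BesovSpace hZ s' hp,
      Function.Injective T ∧
      ∀ (u : BesovSpace hW s hp) (g : W → ℝ), g =ᵐ[νW] BesovSpace.toLp u →
        (BesovSpace.toLp (T u) : Z → ℝ) =ᵐ[νZ] g ∘ f := by
  have hp0 : 0 < p := by linarith
  have hsp' : 0 < s' * p := mul_pos hs' hp0
  have hexp : s' * p + QZ ≤ θ₂ * (s * p + QW) := by
    have h := mul_le_mul_of_nonneg_right hss' hp0.le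
    rw [add_mul, div_mul_cancel₀ _ hp0.ne'] at h
    linarith
  have := hZ.sigmaFinite
  have := hZ.secondCountableTopology
  have := hW.sigmaFinite
  have := hW.secondCountableTopology
  have hfm : Measurable f := f.continuous.measurable
  obtain ⟨c, hc, hmap⟩ := hf.exists_map_le_smul hr hQZ.le hθ₁ hQ hZ hW
  obtain ⟨b, hb, hker⟩ := hf.exists_besovKernel_le hZ hW hQZ hQW.le (by positivity) hsp'.le hexp
  obtain ⟨M, hM, hsemi⟩ :=
    exists_besovSeminorm_comp_le hZ.isDoubling hsp' hp hr hfm hc hmap hb hker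
  exact ⟨BesovSpace.comp hZ hW hp hfm hc hmap hM hsemi,
    BesovSpace.comp_injective hZ hW hp hfm hc hmap hM hsemi hsp' hr f.surjective hb hker,
    fun u g hg => (BesovSpace.coeFn_toLp_comp hZ hW hp hfm hc hmap hM hsemi u).trans
      (ae_eq_comp_of_map_le_smul hfm hmap hg.symm)⟩
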